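/- Let $F$ be a field, $a,b\in F$, and let $\mathbb H=\mathbb H(a,b)$ be the quaternion algebra over $F$ with basis $1,i,j,k$ and $i^2=a$, $j^2=b$, $ij=k=-ji$; let $x\mapsto\bar x$ be its conjugation, which negates the coefficients of $i,j,k$. Let $n\ge 1$, let $A\in M(n,\mathbb H)$, and let $A^*=(\overline{a_{ji}})$ be its Hermitian adjoint. For $M=(m_{ij})\in M(n,\mathbb H)$, $\sigma\in S_n$ and an index $x$ whose $\sigma$-cycle has length $l$, put $M_\sigma(x)=m_{x,\sigma(x)}\,m_{\sigma(x),\sigma^2(x)}\cdots m_{\sigma^{l-1}(x),x}$. For an index $i$ let $x_2<\dots<x_r$ be the minimal elements of the cycles of $\sigma$ (fixed points included) that do not contain $i$, so that $\sigma$ has $r$ cycles. The row and column determinants of $M$ are $$\mathrm{rdet}_i M=\sum_{\sigma\in S_n}(-1)^{n-r}M_\sigma(i)\,M_\sigma(x_2)\cdots M_\sigma(x_r),\qquad \mathrm{cdet}_i M=\sum_{\sigma\in S_n}(-1)^{n-r}M_\sigma(x_r)\cdots M_\sigma(x_2)\,M_\sigma(i).$$ Write $M_{.\,j}(c)$ for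 $M$ with its $j$th column replaced by $c$, $M_{i\,.}(c)$ for $M$ with its $i$th row replaced by $c$, and $A^*_{.\,i}$, $A^*_{j\,.}$ for the $i$th column and the $j$th row of $A^*$. **Theorem.** All row and column determinants $\mathrm{rdet}_i$, $\mathrm{cdet}_i$ ($1\le i\le n$) of $A^*A$ and of $AA^*$ are equal to one and the same element of $F$. Denote it by $\mathrm{ddet}\,A=\det(A^*A)=\det(AA^*)$, the double determinant of $A$. The matrix $A$ is invertible if and only if $\mathrm{ddet}\,A\neq 0$. In that case $A^*A$ and $AA^*$ are invertible too, the left inverse $(LA)^{-1}:=(A^*A)^{-1}A^*$ and the right inverse $(RA)^{-1}:=A^*(AA^*)^{-1}$ of $A$ coincide, $A^{-1}=(LA)^{-1}=(RA)^{-1}$, and for all $i,j$ $$\bigl((LA)^{-1}\bigr)_{ij}=\frac{\mathbb L_{ji}}{\mathrm{ddet}\,A},\qquad \bigl((RA)^{-1}\bigr)_{ij}=\frac{\mathbb R_{ji}}{\mathrm{ddet}\,A^*},$$ where $\mathbb L_{ij}=\mathrm{cdet}_j\,(A^*A)_{.\,j}\bigl(A^*_{.\,i}\bigr)$ and $\mathbb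 R_{ij}=\mathrm{rdet}_i\,(AA^*)_{i\,.}\bigl(A^*_{j\,.}\bigr)$. -/

import Mathlib

open scoped Quaternion Matrix

/-- The product `a_{x,σx} a_{σx,σ²x} ⋯ a_{σ⁻¹x,x}` of the entries along the cycle of `σ` through
`x`, started at row `x` and ended at column `x`; it is `a_{x,x}` if `x` is a fixed point. -/
noncomputable def cycleProd {R : Type*} [Ring R] {n : ℕ} (A : Matrix (Fin n) (Fin n) R)
    (σ : Equiv.Perm (Fin n)) (x : Fin n) : R :=
  ((List.range (Function.minimalPeriod σ x)).map
    fun k => A ((σ ^ k) x) ((σ ^ (k + 1)) x)).prod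

/-- The minimal elements of the cycles of `σ` (fixed points included) that do not contain `i`,
in increasing order. -/
def cycleLeaders {n : ℕ} (σ : Equiv.Perm (Fin n)) (i : Fin n) : List (Fin n) :=
  (List.finRange n).filter fun x => ¬ σ.SameCycle i x ∧ ∀ y, σ.SameCycle x y → x ≤ y

/-- The `i`-th row determinant: the cycle through `i` comes first (leftmost), started at `i`; the
other cycles follow from left to right in the increasing order of their minimal elements, each
started at its minimal element. The sign `(-1)^(n-r)`, where `r` is the number of cycles of `σ`,
is the sign of `σ`. -/
noncomputable def rdet {R : Type*} [Ring R] {n : ℕ} (i : Fin n)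
    (A : Matrix (Fin n) (Fin n) R) : R :=
  ∑ σ : Equiv.Perm (Fin n), (Equiv.Perm.sign σ : ℤ) •
    (cycleProd A σ i * ((cycleLeaders σ i).map (cycleProd A σ)).prod)

/-- The `j`-th column determinant: the cycle through `j` comes last (rightmost), ended at column
`j`; the other cycles are placed from right to left in the increasing order of their minimal
elements, each ended at its minimal element. -/
noncomputable def cdet {R : Type*} [Ring R] {n : ℕ} (j : Fin n)
    (A : Matrix (Fin n) (Fin n) R) : R :=
  ∑ τ : Equiv.Perm (Fin n), (Equiv.Perm.sign τ : ℤ) •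
    (((cycleLeaders τ j).reverse.map (cycleProd A τ)).prod * cycleProd A τ j)

/-- The determinant of a Hermitian quaternion matrix, as an element of the base field: the first
row determinant (for the matrices concerned, all row and column determinants are equal and lie
in the base field, which the main statement asserts too). -/
noncomputable def hermDet {F : Type*} [Field F] {a b : F} {n : ℕ} [NeZero n]
    (M : Matrix (Fin n) (Fin n) ℍ[F,a,b]) : F :=
  (rdet 0 M).re

/-- The double determinant `ddet A = det (A* A)`. -/
noncomputable def ddet {F : Type*} [Field F] {a b : F} {n : ℕ} [NeZero n]
    (A : Matrix (Fin n) (Fin n) ℍ[F,a,b]) : F :=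
  hermDet (Aᴴ * A)

/-- The left double cofactor `𝕃_{ij}`: `cdet_j` of `A* A` with its `j`-th column replaced by the
`i`-th column of `A*`. -/
noncomputable def leftDoubleCofactor {F : Type*} [Field F] {a b : F} {n : ℕ}
    (A : Matrix (Fin n) (Fin n) ℍ[F,a,b]) (i j : Fin n) : ℍ[F,a,b] :=
  cdet j ((Aᴴ * A).updateCol j fun k => Aᴴ k i)

/-- The right double cofactor `ℝ_{ij}`: `rdet_i` of `A A*` with its `i`-th row replaced by the
`j`-th row of `A*`. -/
noncomputable def rightDoubleCofactor {F : Type*} [Field F] {a b : F} {n : ℕ}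
    (A : Matrix (Fin n) (Fin n) ℍ[F,a,b]) (i j : Fin n) : ℍ[F,a,b] :=
  rdet i ((A * Aᴴ).updateRow i fun k => Aᴴ j k)

/-- `(LA)⁻¹ = (A* A)⁻¹ A*`. (`Ring.inverse M` is the two-sided inverse of an invertible `M`.) -/
noncomputable def leftInv {F : Type*} [Field F] {a b : F} {n : ℕ}
    (A : Matrix (Fin n) (Fin n) ℍ[F,a,b]) : Matrix (Fin n) (Fin n) ℍ[F,a,b] :=
  Ring.inverse (Aᴴ * A) * Aᴴ

/-- `(RA)⁻¹ = A* (A A*)⁻¹`. -/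
noncomputable def rightInv {F : Type*} [Field F] {a b : F} {n : ℕ}
    (A : Matrix (Fin n) (Fin n) ℍ[F,a,b]) : Matrix (Fin n) (Fin n) ℍ[F,a,b] :=
  Aᴴ * Ring.inverse (A * Aᴴ)

/-!
Reversing one cycle of a permutation conjugates the corresponding cycle product of a Hermitian
matrix. Pairing every permutation with such a reversal therefore replaces cycle products by their
real parts, one cycle at a time, as long as twice an element determines it; the real parts
are central and do not depend on where a cycle starts, so every row and column determinant equals
the Moore determinant. Multiplication by a transposition merges two cycles, so the same pairing
shows that a column determinant vanishes when another column equals the distinguished one: the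
column cofactors form a left adjugate, and a matrix `A` is invertible as soon as the Moore
determinants of `Aᴴ * A` and `A * Aᴴ` are.

That these two determinants agree follows from multiplicativity. If `B` differs from the identity
in its `j`-th column `c` only, the congruence `Bᴴ * M * B` multiplies the Moore determinant by the
norm of `c j`; if `B` is elementary the same holds for `B * M * Bᴴ`, hence for all products of such
matrices. A matrix specializing to the identity can be reached from the identity by exchanging one
column at a time, and over the fraction field all matrices on the way are invertible because their
determinants specialize to `1`, so it is such a product. Since every matrix over a commutative ring
is a specialization of a matrix of this kind over a polynomial ring over `ℤ`, where `2` is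
cancellable, the identities hold over every commutative ring, also in characteristic two.
-/

section Permutations

open Function Equiv Equiv.Perm

variable {α : Type*} {σ τ : Perm α} {x y j l : α}

theorem sameCycle_iterate (σ : Perm α) (x : α) (k : ℕ) : σ.SameCycle x (σ^[k] x) := by
  rw [iterate_eq_pow]
  exact sameCycle_pow_right.2 (SameCycle.refl σ x)

theorem sameCycle_iff_exists_iterate [Finite α] : σ.SameCycle x y ↔ ∃ k, σ^[k] x = y := by
  refine ⟨fun h => ?_, fun ⟨k, hk⟩ => hk ▸ sameCycle_iterate σ x k⟩
  simpa only [iterate_eq_pow] using h.exists_nat_pow_eq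

theorem minimalPeriod_perm_pos [Finite α] (σ : Perm α) (x : α) : 0 < minimalPeriod σ x :=
  minimalPeriod_pos_of_mem_periodicPts (σ.injective.mem_periodicPts x)

theorem minimalPeriod_perm_inv (σ : Perm α) (x : α) :
    minimalPeriod (σ⁻¹ : Perm α) x = minimalPeriod σ x :=
  MulAction.period_inv σ x

theorem minimalPeriod_eq_of_sameCycle [Finite α] (h : σ.SameCycle x y) :
    minimalPeriod σ y = minimalPeriod σ x := by
  obtain ⟨k, rfl⟩ := sameCycle_iff_exists_iterate.1 h
  exact minimalPeriod_apply_iterate (σ.injective.mem_periodicPts x) k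

theorem iterate_eq_of_eqOn_sameCycle (h : Set.EqOn τ σ {y | σ.SameCycle x y}) (k : ℕ) :
    τ^[k] x = σ^[k] x := by
  induction k with
  | zero => rfl
  | succ k ih =>
    rw [iterate_succ_apply', iterate_succ_apply', ih]
    exact h (sameCycle_iterate σ x k)

theorem sameCycle_iff_of_eqOn_sameCycle [Finite α] (h : Set.EqOn τ σ {y | σ.SameCycle x y}) :
    τ.SameCycle x y ↔ σ.SameCycle x y := by
  simp only [sameCycle_iff_exists_iterate, iterate_eq_of_eqOn_sameCycle h]

theorem minimalPeriod_eq_of_eqOn_sameCycle (h : Set.EqOn τ σ {y | σ.SameCycle x y}) :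
    minimalPeriod τ x = minimalPeriod σ x :=
  minimalPeriod_eq_minimalPeriod_iff.2 fun k => by
    rw [IsPeriodicPt, IsFixedPt, iterate_eq_of_eqOn_sameCycle h, IsPeriodicPt, IsFixedPt]

section ReverseCycle

variable [Fintype α] [DecidableEq α]

/-- The permutation `σ` with its cycle through `x` reversed. Pairing `σ` with it turns the product
`q` along a cycle of a Hermitian matrix into `q + star q`, which is central. -/
def reverseCycle (σ : Perm α) (x : α) : Perm α := σ * (σ.cycleOf x)⁻¹ ^ 2

theorem reverseCycle_eqOn_inv (σ : Perm α) (x : α) :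
    Set.EqOn (reverseCycle σ x) (σ⁻¹ : Perm α) {y | σ⁻¹.SameCycle x y} := fun y hy => by
  have hy' : σ⁻¹.SameCycle x (σ⁻¹ y) := sameCycle_apply_right.2 hy
  rw [reverseCycle, cycleOf_inv, mul_apply, pow_two, mul_apply, hy.cycleOf_apply,
    hy'.cycleOf_apply]
  exact σ.apply_symm_apply (σ⁻¹ y)

theorem reverseCycle_eqOn_of_not_sameCycle (h : ¬ σ.SameCycle x y) :
    Set.EqOn (reverseCycle σ x) σ {z | σ.SameCycle y z} := fun z hz => by
  have hxz : ¬ σ⁻¹.SameCycle x z := fun hxz => h ((sameCycle_inv.1 hxz).trans hz.symm)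
  rw [reverseCycle, cycleOf_inv, mul_apply, pow_two, mul_apply,
    cycleOf_apply_of_not_sameCycle hxz, cycleOf_apply_of_not_sameCycle hxz]

theorem sign_reverseCycle (σ : Perm α) (x : α) : sign (reverseCycle σ x) = sign σ := by
  rw [reverseCycle, map_mul, map_pow, Int.units_sq, mul_one]

theorem sameCycle_reverseCycle {z : α} :
    (reverseCycle σ x).SameCycle y z ↔ σ.SameCycle y z := by
  by_cases h : σ.SameCycle x y
  · have hy : Set.EqOn (reverseCycle σ x) (σ⁻¹ : Perm α) {z | σ⁻¹.SameCycle y z} := fun z hz =>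
      reverseCycle_eqOn_inv σ x ((sameCycle_inv.2 h).trans hz)
    rw [sameCycle_iff_of_eqOn_sameCycle hy, sameCycle_inv]
  · exact sameCycle_iff_of_eqOn_sameCycle (reverseCycle_eqOn_of_not_sameCycle h)

theorem involutive_reverseCycle (x : α) :
    Involutive fun σ : Perm α => reverseCycle σ x := fun σ => by
  ext1 y
  by_cases h : σ.SameCycle x y
  · rw [reverseCycle_eqOn_inv (reverseCycle σ x) x
      (sameCycle_inv.2 (sameCycle_reverseCycle.2 h)), inv_eq_iff_eq,
      reverseCycle_eqOn_inv σ x (sameCycle_inv.2 (sameCycle_apply_right.2 h))]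
    exact (σ.symm_apply_apply y).symm
  · rw [reverseCycle_eqOn_of_not_sameCycle (mt sameCycle_reverseCycle.1 h) (SameCycle.refl _ y),
      reverseCycle_eqOn_of_not_sameCycle h (SameCycle.refl σ y)]

end ReverseCycle

section SwapMul

variable [DecidableEq α]

theorem iterate_swap_mul_of_forall_ne {m : ℕ}
    (h : ∀ k < m, σ^[k + 1] x ≠ j ∧ σ^[k + 1] x ≠ l) :
    (swap j l * σ : Perm α)^[m] x = σ^[m] x := by
  induction m with
  | zero => rfl
  | succ m ih =>
    obtain ⟨hj, hl⟩ := h m m.lt_succ_self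
    rw [iterate_succ_apply', ih fun k hk => h k (hk.trans m.lt_succ_self), mul_apply,
      ← iterate_succ_apply' σ, swap_apply_of_ne_of_ne hj hl]

theorem swap_mul_eqOn_of_not_sameCycle (hj : ¬ σ.SameCycle j x) (hl : ¬ σ.SameCycle l x) :
    Set.EqOn (swap j l * σ : Perm α) σ {y | σ.SameCycle x y} := fun y hy => by
  have hσy : σ.SameCycle x (σ y) := sameCycle_apply_right.2 hy
  exact swap_apply_of_ne_of_ne (fun h => hj (h ▸ hσy.symm)) fun h => hl (h ▸ hσy.symm)

theorem iterate_swap_mul_of_lt_minimalPeriod {k : ℕ} (h : ¬ σ.SameCycle j l)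
    (hk : k < minimalPeriod σ j) : (swap j l * σ : Perm α)^[k] j = σ^[k] j :=
  iterate_swap_mul_of_forall_ne fun i hi =>
    ⟨not_isPeriodicPt_of_pos_of_lt_minimalPeriod i.succ_ne_zero (by omega),
      fun hl => h (hl ▸ sameCycle_iterate σ j (i + 1))⟩

variable [Finite α]

theorem iterate_minimalPeriod_swap_mul (h : ¬ σ.SameCycle j l) :
    (swap j l * σ : Perm α)^[minimalPeriod σ j] j = l := by
  obtain ⟨p, hp⟩ := Nat.exists_eq_add_one.2 (minimalPeriod_perm_pos σ j)
  rw [hp, iterate_succ_apply', iterate_swap_mul_of_lt_minimalPeriod h (by omega), mul_apply,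
    ← iterate_succ_apply' σ, Nat.succ_eq_add_one, ← hp, iterate_minimalPeriod, swap_apply_left]

theorem iterate_swap_mul_add_minimalPeriod {k : ℕ} (h : ¬ σ.SameCycle j l)
    (hk : k < minimalPeriod σ l) :
    (swap j l * σ : Perm α)^[k + minimalPeriod σ j] j = σ^[k] l := by
  rw [iterate_add_apply, iterate_minimalPeriod_swap_mul h, swap_comm]
  exact iterate_swap_mul_of_lt_minimalPeriod (mt SameCycle.symm h) hk

theorem minimalPeriod_swap_mul (h : ¬ σ.SameCycle j l) :
    minimalPeriod (swap j l * σ : Perm α) j = minimalPeriod σ j + minimalPeriod σ l := by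
  have hpos : 0 < minimalPeriod σ j + minimalPeriod σ l :=
    Nat.add_pos_left (minimalPeriod_perm_pos σ j) _
  have hper : IsPeriodicPt (swap j l * σ : Perm α) (minimalPeriod σ j + minimalPeriod σ l) j := by
    rw [IsPeriodicPt, IsFixedPt, add_comm, iterate_add_apply, iterate_minimalPeriod_swap_mul h,
      swap_comm, iterate_minimalPeriod_swap_mul (mt SameCycle.symm h)]
  refine le_antisymm (hper.minimalPeriod_le hpos) (not_lt.1 fun hlt => ?_)
  have hτ := iterate_minimalPeriod (f := (swap j l * σ : Perm α)) (x := j)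
  have hτpos := minimalPeriod_perm_pos (swap j l * σ) j
  rcases lt_or_ge (minimalPeriod (swap j l * σ : Perm α) j) (minimalPeriod σ j) with hj | hj
  · rw [iterate_swap_mul_of_lt_minimalPeriod h hj] at hτ
    exact not_isPeriodicPt_of_pos_of_lt_minimalPeriod hτpos.ne' hj hτ
  · obtain ⟨k, hk⟩ := Nat.exists_eq_add_of_le' hj
    rw [hk, iterate_swap_mul_add_minimalPeriod h (by omega)] at hτ
    exact h (hτ ▸ (sameCycle_iterate σ l k).symm)

theorem sameCycle_swap_mul_left_iff (h : ¬ σ.SameCycle j l) :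
    (swap j l * σ).SameCycle j y ↔ σ.SameCycle j y ∨ σ.SameCycle l y := by
  constructor
  · intro hy
    obtain ⟨k, rfl⟩ := sameCycle_iff_exists_iterate.1 hy
    clear hy
    induction k with
    | zero => exact Or.inl (SameCycle.refl σ j)
    | succ k ih =>
      rw [iterate_succ_apply', mul_apply, swap_apply_def]
      split_ifs
      · exact Or.inr (SameCycle.refl σ l)
      · exact Or.inl (SameCycle.refl σ j)
      · exact ih.imp sameCycle_apply_right.2 sameCycle_apply_right.2
  · rintro (hy | hy) <;> obtain ⟨k, rfl⟩ := sameCycle_iff_exists_iterate.1 hy <;>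
      rw [← iterate_mod_minimalPeriod_eq]
    · rw [← iterate_swap_mul_of_lt_minimalPeriod h (Nat.mod_lt _ (minimalPeriod_perm_pos σ j))]
      exact sameCycle_iterate _ j _
    · rw [← iterate_swap_mul_add_minimalPeriod h (Nat.mod_lt _ (minimalPeriod_perm_pos σ l))]
      exact sameCycle_iterate _ j _

theorem not_sameCycle_swap_mul (hjl : j ≠ l) (h : σ.SameCycle j l) :
    ¬ (swap j l * σ).SameCycle j l := by
  have hex := sameCycle_iff_exists_iterate.1 h
  obtain ⟨m, hm, hmin⟩ : ∃ m, σ^[m] j = l ∧ ∀ k < m, σ^[k] j ≠ l :=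
    ⟨Nat.find hex, Nat.find_spec hex, fun _ => Nat.find_min hex⟩
  obtain ⟨p, rfl⟩ : ∃ p, m = p + 1 :=
    Nat.exists_eq_add_one.2 (Nat.pos_of_ne_zero fun h0 => hjl (by simpa [h0] using hm))
  have hne : ∀ k < p, σ^[k + 1] j ≠ j ∧ σ^[k + 1] j ≠ l := fun k hk => by
    refine ⟨fun hj => ?_, hmin _ (by omega)⟩
    have hper : IsPeriodicPt σ (k + 1) j := hj
    refine hmin ((p + 1) % (k + 1)) ((Nat.mod_lt _ k.succ_pos).trans (by omega)) ?_
    rw [hper.iterate_mod_apply, hm]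
  have hiter : ∀ k ≤ p, (swap j l * σ : Perm α)^[k] j = σ^[k] j := fun k hk =>
    iterate_swap_mul_of_forall_ne fun i hi => hne i (by omega)
  have hper : IsPeriodicPt (swap j l * σ : Perm α) (p + 1) j := by
    rw [IsPeriodicPt, IsFixedPt, iterate_succ_apply', hiter p le_rfl, mul_apply,
      ← iterate_succ_apply' σ, hm, swap_apply_right]
  intro hτ
  obtain ⟨k, hk⟩ := sameCycle_iff_exists_iterate.1 hτ
  have hlt : k % (p + 1) < p + 1 := Nat.mod_lt k p.succ_pos
  rw [← hper.iterate_mod_apply, hiter _ (by omega)] at hk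
  exact hmin _ hlt hk

theorem sameCycle_swap_mul_iff (hjl : j ≠ l) :
    (swap j l * σ).SameCycle j l ↔ ¬ σ.SameCycle j l :=
  ⟨fun h h' => not_sameCycle_swap_mul hjl h' h, fun h =>
    (sameCycle_swap_mul_left_iff h).2 (Or.inr (SameCycle.refl σ l))⟩

end SwapMul

end Permutations

section Sums

theorem sum_eq_sum_of_involutive {ι A : Type*} [Fintype ι] [AddCommMonoid A] [IsAddTorsionFree A]
    {e : ι → ι} (he : Function.Involutive e) {f g : ι → A}
    (h : ∀ i, f i + f (e i) = g i + g (e i)) : ∑ i, f i = ∑ i, g i := by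
  have hdouble : ∀ f : ι → A, 2 • ∑ i, f i = ∑ i, (f i + f (e i)) := fun f => by
    rw [Finset.sum_add_distrib, two_nsmul]
    exact congrArg _ (Equiv.sum_comp he.toPerm f).symm
  refine nsmul_right_injective two_ne_zero ?_
  simp only [hdouble, h]

theorem sum_eq_sum_ite_add_of_perm {ι A : Type*} [Fintype ι] [AddCommMonoid A]
    {p : ι → Prop} [DecidablePred p] (e : Equiv.Perm ι) (hp : ∀ i, p (e i) ↔ ¬ p i) (f : ι → A) :
    ∑ i, f i = ∑ i, if p i then f i + f (e i) else 0 := by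
  have hnot : ∑ i, (if p i then 0 else f i) = ∑ i, if p i then f (e i) else 0 := by
    rw [← Equiv.sum_comp e]
    exact Finset.sum_congr rfl fun i _ => by simp only [hp, ite_not]
  calc ∑ i, f i = ∑ i, ((if p i then f i else 0) + if p i then 0 else f i) :=
        Finset.sum_congr rfl fun i _ => by split_ifs <;> simp
    _ = ∑ i, ((if p i then f i else 0) + if p i then f (e i) else 0) := by
        rw [Finset.sum_add_distrib, hnot, ← Finset.sum_add_distrib]
    _ = ∑ i, if p i then f i + f (e i) else 0 :=
        Finset.sum_congr rfl fun i _ => by split_ifs <;> simp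

theorem exists_prod_map_update_eq_mul_mul {ι R : Type*} [DecidableEq ι] [Monoid R] {L : List ι}
    (hL : L.Nodup) {k : ι} (hk : k ∈ L) (w : ι → R) :
    ∃ u v, ∀ x, (L.map (Function.update w k x)).prod = u * x * v := by
  obtain ⟨L₁, L₂, rfl⟩ := List.append_of_mem hk
  obtain ⟨h₁, h₂⟩ : k ∉ L₁ ∧ k ∉ L₂ := by
    simpa using (List.nodup_cons.1 (List.perm_middle.nodup_iff.1 hL)).1
  have hupdate : ∀ {L : List ι}, k ∉ L → ∀ x, L.map (Function.update w k x) = L.map w :=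
    fun h x => List.map_congr_left fun y hy =>
      Function.update_of_ne (ne_of_mem_of_not_mem hy h) x w
  refine ⟨(L₁.map w).prod, (L₂.map w).prod, fun x => ?_⟩
  rw [List.map_append, List.map_cons, Function.update_self, hupdate h₁, hupdate h₂,
    List.prod_append, List.prod_cons, mul_assoc]

theorem star_list_prod {R : Type*} [Monoid R] [StarMul R] (L : List R) :
    star L.prod = (L.map star).reverse.prod :=
  unop_map_list_prod (starMulEquiv : R ≃* Rᵐᵒᵖ) L

end Sums

section CycleProd

open Function Equiv Equiv.Perm

variable {R : Type*} [Ring R] {n : ℕ} {σ τ : Perm (Fin n)} {x y j l : Fin n}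

theorem cycleProd_eq_prod_iterate (M : Matrix (Fin n) (Fin n) R) (σ : Perm (Fin n)) (x : Fin n) :
    cycleProd M σ x =
      ((List.range (minimalPeriod σ x)).map fun k => M (σ^[k] x) (σ^[k + 1] x)).prod := by
  simp only [cycleProd, iterate_eq_pow]

theorem cycleProd_congr {M N : Matrix (Fin n) (Fin n) R}
    (hτ : Set.EqOn τ σ {y | σ.SameCycle x y})
    (hMN : ∀ y, σ.SameCycle x y → N y (σ y) = M y (σ y)) :
    cycleProd N τ x = cycleProd M σ x := by
  rw [cycleProd_eq_prod_iterate, cycleProd_eq_prod_iterate, minimalPeriod_eq_of_eqOn_sameCycle hτ]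
  refine congrArg List.prod (List.map_congr_left fun k _ => ?_)
  rw [iterate_eq_of_eqOn_sameCycle hτ, iterate_eq_of_eqOn_sameCycle hτ, iterate_succ_apply']
  exact hMN _ (sameCycle_iterate σ x k)

theorem map_cycleProd {S : Type*} [Ring S] (f : R →+* S) (M : Matrix (Fin n) (Fin n) R)
    (σ : Perm (Fin n)) (x : Fin n) : f (cycleProd M σ x) = cycleProd (M.map f) σ x := by
  simp only [cycleProd, map_list_prod, List.map_map, comp_def, Matrix.map_apply]

theorem star_cycleProd [StarRing R] (M : Matrix (Fin n) (Fin n) R) (σ : Perm (Fin n))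
    (x : Fin n) : star (cycleProd M σ x) = cycleProd Mᴴ σ⁻¹ x := by
  rw [cycleProd_eq_prod_iterate, cycleProd_eq_prod_iterate, star_list_prod,
    minimalPeriod_perm_inv]
  refine congrArg List.prod (List.ext_getElem (by simp) fun k hk _ => ?_)
  have hkp : k < minimalPeriod σ x := by simpa using hk
  have hinv : ∀ m ≤ minimalPeriod σ x,
      (σ⁻¹ : Perm (Fin n))^[m] x = σ^[minimalPeriod σ x - m] x := fun m hm => by
    rw [iterate_eq_pow, inv_pow, inv_eq_iff_eq, ← iterate_eq_pow, ← iterate_add_apply,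
      Nat.add_sub_cancel' hm, iterate_minimalPeriod]
  simp only [List.getElem_reverse, List.getElem_map, List.getElem_range, List.length_map,
    List.length_range, Matrix.conjTranspose_apply, hinv k hkp.le, hinv (k + 1) hkp]
  rw [show minimalPeriod σ x - 1 - k + 1 = minimalPeriod σ x - k by omega, Nat.sub_sub,
    Nat.add_comm 1 k]

theorem exists_cycleProd_eq_mul (M : Matrix (Fin n) (Fin n) R) (σ : Perm (Fin n)) (x : Fin n) :
    ∃ u, cycleProd M σ x = M x (σ x) * u ∧ cycleProd M σ (σ x) = u * M x (σ x) := by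
  obtain ⟨p, hp⟩ := Nat.exists_eq_add_one.2 (minimalPeriod_perm_pos σ x)
  have hpσ : minimalPeriod σ (σ x) = p + 1 :=
    hp ▸ minimalPeriod_eq_of_sameCycle (sameCycle_apply_right.2 (SameCycle.refl σ x))
  have hx : σ^[p] (σ x) = x := by
    rw [← iterate_succ_apply, Nat.succ_eq_add_one, ← hp, iterate_minimalPeriod]
  refine ⟨((List.range p).map fun k => M (σ^[k] (σ x)) (σ^[k + 1] (σ x))).prod, ?_, ?_⟩
  · rw [cycleProd_eq_prod_iterate, hp, List.prod_range_succ']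
    rfl
  · rw [cycleProd_eq_prod_iterate, hpσ, List.prod_range_succ, iterate_succ_apply', hx]

theorem exists_cycleProd_updateCol_eq_mul (M : Matrix (Fin n) (Fin n) R) (σ : Perm (Fin n))
    (j : Fin n) : ∃ u, ∀ c, cycleProd (M.updateCol j c) σ j = u * c (σ⁻¹ j) := by
  obtain ⟨p, hp⟩ := Nat.exists_eq_add_one.2 (minimalPeriod_perm_pos σ j)
  have hj : σ^[p + 1] j = j := hp ▸ iterate_minimalPeriod
  have hinv : σ^[p] j = σ⁻¹ j := by rw [eq_inv_iff_eq, ← iterate_succ_apply' σ, hj]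
  refine ⟨((List.range p).map fun k => M (σ^[k] j) (σ^[k + 1] j)).prod, fun c => ?_⟩
  rw [cycleProd_eq_prod_iterate, hp, List.prod_range_succ, hj, hinv, Matrix.updateCol_self]
  congr 2
  refine List.map_congr_left fun k hk => Matrix.updateCol_ne ?_
  exact not_isPeriodicPt_of_pos_of_lt_minimalPeriod k.succ_ne_zero
    (by have := List.mem_range.1 hk; omega)

theorem cycleProd_updateCol_of_not_sameCycle (M : Matrix (Fin n) (Fin n) R) (c : Fin n → R)
    (h : ¬ σ.SameCycle j x) : cycleProd (M.updateCol j c) σ x = cycleProd M σ x :=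
  cycleProd_congr (Set.eqOn_refl _ _) fun _ hy =>
    Matrix.updateCol_ne fun hj => h (hj ▸ (sameCycle_apply_right.2 hy).symm)

theorem cycleProd_reverseCycle_of_not_sameCycle (M : Matrix (Fin n) (Fin n) R)
    (h : ¬ σ.SameCycle x y) : cycleProd M (reverseCycle σ x) y = cycleProd M σ y :=
  cycleProd_congr (reverseCycle_eqOn_of_not_sameCycle h) fun _ _ => rfl

theorem cycleProd_reverseCycle_self [StarRing R] {M : Matrix (Fin n) (Fin n) R}
    (hM : ∀ y z, σ.SameCycle x y → σ.SameCycle x z → star (M z y) = M y z) :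
    cycleProd M (reverseCycle σ x) x = star (cycleProd M σ x) := by
  rw [star_cycleProd]
  refine cycleProd_congr (reverseCycle_eqOn_inv σ x) fun y hy => (hM _ _ ?_ ?_).symm
  · exact sameCycle_inv.1 hy
  · exact sameCycle_inv.1 (sameCycle_apply_right.2 hy)

theorem cycleProd_swap_mul {M : Matrix (Fin n) (Fin n) R} (h : ¬ σ.SameCycle j l)
    (hM : ∀ x, M x j = M x l) :
    cycleProd M (swap j l * σ) j = cycleProd M σ j * cycleProd M σ l := by
  have hswap : ∀ x y, M x (swap j l y) = M x y := fun x y => by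
    rw [swap_apply_def]
    split_ifs with hj hl
    · rw [hj, hM]
    · rw [hl, hM]
    · rfl
  simp only [cycleProd_eq_prod_iterate, iterate_succ_apply' (swap j l * σ : Perm (Fin n)),
    mul_apply, hswap, minimalPeriod_swap_mul h, List.range_add, List.map_append, List.prod_append,
    List.map_map, comp_def]
  congr 2 <;> refine List.map_congr_left fun k hk => ?_ <;> have hk := List.mem_range.1 hk
  · rw [iterate_swap_mul_of_lt_minimalPeriod h hk, iterate_succ_apply' σ]
  · rw [add_comm _ k, iterate_swap_mul_add_minimalPeriod h hk, iterate_succ_apply' σ]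

end CycleProd

section CycleMinima

open Function Equiv Equiv.Perm

variable {n : ℕ} {σ τ : Perm (Fin n)} {i j x y : Fin n}

/-- The set of the minimal elements of the cycles of `σ` (fixed points included), one
representative for every cycle. -/
def cycleMinima (σ : Perm (Fin n)) : Finset (Fin n) := {x | ∀ y, σ.SameCycle x y → x ≤ y}

theorem mem_cycleMinima : x ∈ cycleMinima σ ↔ ∀ y, σ.SameCycle x y → x ≤ y := by
  simp [cycleMinima]

theorem exists_mem_cycleMinima_sameCycle (σ : Perm (Fin n)) (j : Fin n) :
    ∃ x ∈ cycleMinima σ, σ.SameCycle j x := by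
  obtain ⟨x, hx, hmin⟩ := Set.exists_min_image {x | σ.SameCycle j x} id (Set.toFinite _)
    ⟨j, SameCycle.refl σ j⟩
  exact ⟨x, mem_cycleMinima.2 fun y hy => hmin y (SameCycle.trans hx hy), hx⟩

theorem eq_of_mem_cycleMinima (hx : x ∈ cycleMinima σ) (hy : y ∈ cycleMinima σ)
    (h : σ.SameCycle x y) : x = y :=
  le_antisymm (mem_cycleMinima.1 hx y h) (mem_cycleMinima.1 hy x h.symm)

theorem mem_cycleLeaders : x ∈ cycleLeaders σ i ↔ ¬ σ.SameCycle i x ∧ x ∈ cycleMinima σ := by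
  simp [cycleLeaders, mem_cycleMinima]

theorem nodup_cycleLeaders (σ : Perm (Fin n)) (i : Fin n) : (cycleLeaders σ i).Nodup :=
  (List.nodup_finRange n).filter _

theorem cycleLeaders_congr (h : ∀ x y, τ.SameCycle x y ↔ σ.SameCycle x y) (i : Fin n) :
    cycleLeaders τ i = cycleLeaders σ i := by
  simp only [cycleLeaders, h]

theorem cycleLeaders_inv (σ : Perm (Fin n)) (i : Fin n) : cycleLeaders σ⁻¹ i = cycleLeaders σ i :=
  cycleLeaders_congr (fun _ _ => sameCycle_inv) i

theorem cycleLeaders_reverseCycle (σ : Perm (Fin n)) (x i : Fin n) :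
    cycleLeaders (reverseCycle σ x) i = cycleLeaders σ i :=
  cycleLeaders_congr (fun _ _ => sameCycle_reverseCycle) i

theorem star_cdet {R : Type*} [Ring R] [StarRing R] (M : Matrix (Fin n) (Fin n) R) (j : Fin n) :
    star (cdet j M) = rdet j Mᴴ := by
  rw [cdet, rdet, star_sum]
  refine Fintype.sum_equiv (Equiv.inv (Perm (Fin n))) _ _ fun σ => ?_
  rw [Equiv.inv_apply, sign_inv, star_zsmul, star_mul, star_cycleProd, cycleLeaders_inv,
    star_list_prod, List.map_map, ← List.map_reverse, List.reverse_reverse]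
  simp only [comp_def, star_cycleProd]

end CycleMinima

section QuaternionAlgebra

open QuaternionAlgebra

variable {R : Type*} [CommRing R] {a b : R}

instance [IsAddTorsionFree R] : IsAddTorsionFree ℍ[R,a,b] where
  nsmul_right_injective m hm x y h := by
    have hinj := nsmul_right_injective (M := R) hm
    ext
    · exact hinj (congrArg re h)
    · exact hinj (congrArg imI h)
    · exact hinj (congrArg imJ h)
    · exact hinj (congrArg imK h)

theorem re_quaternion_mul_comm (x y : ℍ[R,a,b]) : (x * y).re = (y * x).re := by
  simp only [re_mul]
  ring

theorem quaternion_add_star (x : ℍ[R,a,b]) : x + star x = (x.re : ℍ[R,a,b]) + x.re := by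
  rw [self_add_star', zero_mul, add_zero, two_mul, coe_add]

theorem re_cycleProd_eq_of_sameCycle {n : ℕ} (M : Matrix (Fin n) (Fin n) ℍ[R,a,b])
    {σ : Equiv.Perm (Fin n)} {x y : Fin n} (h : σ.SameCycle x y) :
    (cycleProd M σ y).re = (cycleProd M σ x).re := by
  obtain ⟨k, rfl⟩ := sameCycle_iff_exists_iterate.1 h
  clear h
  induction k with
  | zero => rfl
  | succ k ih =>
    obtain ⟨u, hu, hu'⟩ := exists_cycleProd_eq_mul M σ (σ^[k] x)
    rw [Function.iterate_succ_apply', hu', re_quaternion_mul_comm, ← hu, ih]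

end QuaternionAlgebra

section MooreDet

open Function Equiv Equiv.Perm

variable {R : Type*} [CommRing R] {a b : R} {n : ℕ} {σ τ : Perm (Fin n)} {s t : Finset (Fin n)}
  {j l x : Fin n}

/-- The product, over the cycles of `σ` that contain no element of `s`, of the real part of the
product of the entries of `M` along the cycle. -/
noncomputable def cycleReProd (M : Matrix (Fin n) (Fin n) ℍ[R,a,b]) (σ : Perm (Fin n))
    (s : Finset (Fin n)) : R :=
  ∏ x ∈ cycleMinima σ with ∀ i ∈ s, ¬ σ.SameCycle i x, (cycleProd M σ x).re

/-- The Moore determinant: the determinant of a Hermitian quaternion matrix with values in the base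
ring. It is defined for all matrices by taking real parts along the cycles, which for a Hermitian
matrix gives the usual sum because a cycle and its inverse contribute conjugate products. -/
noncomputable def mooreDet (M : Matrix (Fin n) (Fin n) ℍ[R,a,b]) : R :=
  ∑ σ : Perm (Fin n), (sign σ : ℤ) • cycleReProd M σ ∅

theorem cycleReProd_congr {M N : Matrix (Fin n) (Fin n) ℍ[R,a,b]}
    (hmeet : ∀ x, (∀ i ∈ t, ¬ τ.SameCycle i x) ↔ ∀ i ∈ s, ¬ σ.SameCycle i x)
    (hcycle : ∀ x, (∀ i ∈ s, ¬ σ.SameCycle i x) → ∀ y, τ.SameCycle x y ↔ σ.SameCycle x y)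
    (hre : ∀ x, (∀ i ∈ s, ¬ σ.SameCycle i x) → (cycleProd N τ x).re = (cycleProd M σ x).re) :
    cycleReProd N τ t = cycleReProd M σ s := by
  refine Finset.prod_congr (Finset.ext fun x => ?_) fun x hx => ?_
  · simp only [Finset.mem_filter, hmeet, mem_cycleMinima]
    exact and_congr_left fun hx => by simp only [hcycle x hx]
  · exact hre x (Finset.mem_filter.1 hx).2

theorem cycleReProd_insert_mul_re (M : Matrix (Fin n) (Fin n) ℍ[R,a,b])
    (hl : ∀ i ∈ s, ¬ σ.SameCycle i l) :
    cycleReProd M σ (insert l s) * (cycleProd M σ l).re = cycleReProd M σ s := by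
  obtain ⟨m, hm, hlm⟩ := exists_mem_cycleMinima_sameCycle σ l
  have herase : {x ∈ cycleMinima σ | ∀ i ∈ insert l s, ¬ σ.SameCycle i x} =
      {x ∈ cycleMinima σ | ∀ i ∈ s, ¬ σ.SameCycle i x}.erase m := by
    ext x
    have hx : x ∈ cycleMinima σ → (σ.SameCycle l x ↔ x = m) := fun hx =>
      ⟨fun h => (eq_of_mem_cycleMinima hm hx (hlm.symm.trans h)).symm, fun h => h ▸ hlm⟩
    simp only [Finset.mem_filter, Finset.mem_erase, Finset.forall_mem_insert]
    grind
  rw [cycleReProd, herase, ← re_cycleProd_eq_of_sameCycle M hlm]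
  refine Finset.prod_erase_mul _ _ (Finset.mem_filter.2 ⟨hm, fun i hi him => ?_⟩)
  exact hl i hi (him.trans hlm.symm)

theorem cycleReProd_reverseCycle (M : Matrix (Fin n) (Fin n) ℍ[R,a,b]) (hx : x ∈ s) :
    cycleReProd M (reverseCycle σ x) s = cycleReProd M σ s :=
  cycleReProd_congr (fun _ => by simp only [sameCycle_reverseCycle])
    (fun _ _ _ => sameCycle_reverseCycle) fun _ hy =>
    congrArg _ (cycleProd_reverseCycle_of_not_sameCycle M (hy x hx))

theorem cycleReProd_swap_mul (M : Matrix (Fin n) (Fin n) ℍ[R,a,b]) (h : ¬ σ.SameCycle j l) :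
    cycleReProd M (swap j l * σ) {j} = cycleReProd M σ {j, l} := by
  have heqOn : ∀ x, (∀ i ∈ ({j, l} : Finset (Fin n)), ¬ σ.SameCycle i x) →
      Set.EqOn (swap j l * σ : Perm (Fin n)) σ {y | σ.SameCycle x y} := fun x hx =>
    swap_mul_eqOn_of_not_sameCycle (hx j (by simp)) (hx l (by simp))
  refine cycleReProd_congr (fun x => ?_)
    (fun x hx y => sameCycle_iff_of_eqOn_sameCycle (heqOn x hx))
    fun x hx => congrArg _ (cycleProd_congr (heqOn x hx) fun _ _ => rfl)
  simp [sameCycle_swap_mul_left_iff h]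

theorem cycleReProd_conjTranspose (M : Matrix (Fin n) (Fin n) ℍ[R,a,b]) (σ : Perm (Fin n))
    (s : Finset (Fin n)) : cycleReProd Mᴴ σ⁻¹ s = cycleReProd M σ s :=
  cycleReProd_congr (fun _ => by simp only [sameCycle_inv]) (fun _ _ _ => sameCycle_inv)
    fun x _ => by rw [← star_cycleProd, QuaternionAlgebra.re_star, zero_mul, add_zero]

end MooreDet

section HermitianOff

open Function Equiv Equiv.Perm

/-- The matrix `N` is Hermitian outside of row `j` and column `j`; this holds for a Hermitian
matrix whose `j`-th row or column has been replaced. -/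
def IsHermitianOff {ι R : Type*} [Star R] (N : Matrix ι ι R) (j : ι) : Prop :=
  ∀ x y, x ≠ j → y ≠ j → star (N y x) = N x y

section

variable {ι R : Type*} [Star R] {M N : Matrix ι ι R} {j : ι}

theorem isHermitianOff_of_isHermitian (hM : M.IsHermitian) (j : ι) : IsHermitianOff M j :=
  fun x y _ _ => hM.apply x y

theorem IsHermitianOff.updateCol [DecidableEq ι] (hN : IsHermitianOff N j) (c : ι → R) :
    IsHermitianOff (N.updateCol j c) j := fun x y hx hy => by
  rw [Matrix.updateCol_ne hx, Matrix.updateCol_ne hy, hN x y hx hy]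

theorem IsHermitianOff.conjTranspose (hN : IsHermitianOff N j) : IsHermitianOff Nᴴ j :=
  fun x y hx hy => congrArg star (hN y x hy hx)

end

variable {R : Type*} [CommRing R] {a b : R} {n : ℕ} {M N : Matrix (Fin n) (Fin n) ℍ[R,a,b]}
  {σ : Perm (Fin n)} {j k l : Fin n}

theorem IsHermitianOff.cycleProd_reverseCycle {R : Type*} [Ring R] [StarRing R]
    {N : Matrix (Fin n) (Fin n) R} (hN : IsHermitianOff N j) (h : ¬ σ.SameCycle j k) :
    cycleProd N (reverseCycle σ k) k = star (cycleProd N σ k) := by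
  have hne : ∀ {y}, σ.SameCycle k y → y ≠ j := fun hy hj => h (hj ▸ hy.symm)
  exact cycleProd_reverseCycle_self fun y z hy hz => hN y z (hne hy) (hne hz)

/-- The summand of the column determinant for `σ`, with the products along the cycles whose minimal
elements lie in `s` replaced by their real parts; it interpolates between the column determinant
(`s = ∅`) and an expression without ordered products (`s = univ`). -/
noncomputable def cdetTerm (N : Matrix (Fin n) (Fin n) ℍ[R,a,b]) (j : Fin n) (s : Finset (Fin n))
    (σ : Perm (Fin n)) : ℍ[R,a,b] :=
  (sign σ : ℤ) • (((cycleLeaders σ j).reverse.map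
    (s.piecewise (fun x => ((cycleProd N σ x).re : ℍ[R,a,b])) (cycleProd N σ))).prod *
      cycleProd N σ j)

theorem cdetTerm_insert_of_notMem_cycleLeaders (N : Matrix (Fin n) (Fin n) ℍ[R,a,b])
    (s : Finset (Fin n)) (hk : k ∉ cycleLeaders σ j) :
    cdetTerm N j (insert k s) σ = cdetTerm N j s σ := by
  rw [cdetTerm, cdetTerm]
  congr 3
  refine List.map_congr_left fun x hx => Finset.piecewise_insert_of_ne _ _ _ ?_
  exact ne_of_mem_of_not_mem (List.mem_reverse.1 hx) hk

theorem exists_cdetTerm_eq_mul_mul (N : Matrix (Fin n) (Fin n) ℍ[R,a,b]) {s : Finset (Fin n)}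
    (hks : k ∉ s) (hk : k ∈ cycleLeaders σ j) :
    ∃ u v, ∀ τ ∈ ({σ, reverseCycle σ k} : Set (Perm (Fin n))),
      cdetTerm N j s τ = u * cycleProd N τ k * v ∧
      cdetTerm N j (insert k s) τ = u * ((cycleProd N τ k).re : ℍ[R,a,b]) * v := by
  obtain ⟨hjk, hkmin⟩ := mem_cycleLeaders.1 hk
  let w (τ : Perm (Fin n)) : Fin n → ℍ[R,a,b] :=
    s.piecewise (fun x => ((cycleProd N τ x).re : ℍ[R,a,b])) (cycleProd N τ)
  obtain ⟨u, v, huv⟩ := exists_prod_map_update_eq_mul_mul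
    (List.nodup_reverse.2 (nodup_cycleLeaders σ j)) (List.mem_reverse.2 hk) (w σ)
  have hterm : ∀ τ ∈ ({σ, reverseCycle σ k} : Set (Perm (Fin n))), ∀ q,
      (sign τ : ℤ) • (((cycleLeaders τ j).reverse.map (update (w τ) k q)).prod *
        cycleProd N τ j) = (sign σ : ℤ) • u * q * (v * cycleProd N σ j) := by
    rintro τ (rfl | rfl) q
    · rw [huv, smul_mul_assoc, smul_mul_assoc, mul_assoc (u * q)]
    have hw : ∀ x ∈ (cycleLeaders σ j).reverse,
        update (w (reverseCycle σ k)) k q x = update (w σ) k q x := fun x hx => by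
      rcases eq_or_ne x k with rfl | hxk
      · rw [update_self, update_self]
      have hkx : ¬ σ.SameCycle k x := fun h =>
        hxk (eq_of_mem_cycleMinima hkmin (mem_cycleLeaders.1 (List.mem_reverse.1 hx)).2 h).symm
      simp only [update_of_ne hxk, w, Finset.piecewise,
        cycleProd_reverseCycle_of_not_sameCycle N hkx]
    rw [sign_reverseCycle, cycleLeaders_reverseCycle, List.map_congr_left hw, huv,
      cycleProd_reverseCycle_of_not_sameCycle N (mt SameCycle.symm hjk), smul_mul_assoc,
      smul_mul_assoc, mul_assoc (u * q)]
  refine ⟨(sign σ : ℤ) • u, v * cycleProd N σ j, fun τ hτ => ⟨?_, ?_⟩⟩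
  · have hself : update (w τ) k (cycleProd N τ k) = w τ :=
      update_eq_self_iff.2 (Finset.piecewise_eq_of_notMem _ _ _ hks).symm
    rw [← hterm τ hτ, hself, cdetTerm]
  · rw [← hterm τ hτ, cdetTerm, Finset.piecewise_insert]

theorem cdetTerm_add_reverseCycle (hN : IsHermitianOff N j) {s : Finset (Fin n)} (hks : k ∉ s)
    (hk : k ∈ cycleLeaders σ j) :
    cdetTerm N j s σ + cdetTerm N j s (reverseCycle σ k) =
      cdetTerm N j (insert k s) σ + cdetTerm N j (insert k s) (reverseCycle σ k) := by
  obtain ⟨u, v, huv⟩ := exists_cdetTerm_eq_mul_mul N hks hk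
  obtain ⟨hσ, hσ'⟩ := huv σ (Set.mem_insert _ _)
  obtain ⟨hτ, hτ'⟩ := huv (reverseCycle σ k) (Set.mem_insert_of_mem _ rfl)
  rw [hσ, hσ', hτ, hτ', ← add_mul, ← add_mul, ← mul_add, ← mul_add,
    hN.cycleProd_reverseCycle (mem_cycleLeaders.1 hk).1, quaternion_add_star,
    QuaternionAlgebra.re_star, zero_mul, add_zero]

theorem IsHermitianOff.cdet_eq_sum_cycleReProd [IsAddTorsionFree R] (hN : IsHermitianOff N j) :
    cdet j N = ∑ σ : Perm (Fin n), (sign σ : ℤ) • cycleReProd N σ {j} • cycleProd N σ j := by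
  have hinterpolate : ∀ s : Finset (Fin n), cdet j N = ∑ σ, cdetTerm N j s σ := fun s => by
    induction s using Finset.induction_on with
    | empty => simp only [cdet, cdetTerm, Finset.piecewise_empty]
    | insert k s hks ih =>
      refine ih.trans (sum_eq_sum_of_involutive (involutive_reverseCycle k) fun σ => ?_)
      by_cases hk : k ∈ cycleLeaders σ j
      · exact cdetTerm_add_reverseCycle hN hks hk
      · have hk' : k ∉ cycleLeaders (reverseCycle σ k) j := by rwa [cycleLeaders_reverseCycle]
        rw [cdetTerm_insert_of_notMem_cycleLeaders N s hk,
          cdetTerm_insert_of_notMem_cycleLeaders N s hk']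
  rw [hinterpolate Finset.univ]
  refine Finset.sum_congr rfl fun σ _ => ?_
  have hset : (cycleLeaders σ j).toFinset =
      {x ∈ cycleMinima σ | ∀ i ∈ ({j} : Finset (Fin n)), ¬ σ.SameCycle i x} := by
    ext x
    simp [mem_cycleLeaders, and_comm]
  rw [cdetTerm, Finset.piecewise_univ, cycleReProd, ← hset,
    List.prod_toFinset _ (nodup_cycleLeaders σ j), ← QuaternionAlgebra.coe_mul_eq_smul,
    ← (List.reverse_perm _).prod_eq, ← List.map_reverse, ← QuaternionAlgebra.coe_algebraMap,
    map_list_prod, List.map_map]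
  rfl

theorem cycleReProd_conjTranspose_smul_star (N : Matrix (Fin n) (Fin n) ℍ[R,a,b])
    (σ : Perm (Fin n)) (j : Fin n) :
    star ((sign σ : ℤ) • cycleReProd N σ {j} • cycleProd N σ j) =
      (sign σ⁻¹ : ℤ) • cycleReProd Nᴴ σ⁻¹ {j} • cycleProd Nᴴ σ⁻¹ j := by
  rw [star_zsmul, QuaternionAlgebra.star_smul, star_cycleProd, sign_inv, cycleReProd_conjTranspose]

theorem IsHermitianOff.rdet_eq_cdet [IsAddTorsionFree R] (hN : IsHermitianOff N j) :
    rdet j N = cdet j N := by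
  rw [← Matrix.conjTranspose_conjTranspose N, ← star_cdet, Matrix.conjTranspose_conjTranspose,
    hN.conjTranspose.cdet_eq_sum_cycleReProd, hN.cdet_eq_sum_cycleReProd, star_sum]
  refine Fintype.sum_equiv (Equiv.inv (Perm (Fin n))) _ _ fun σ => ?_
  rw [Equiv.inv_apply, cycleReProd_conjTranspose_smul_star, Matrix.conjTranspose_conjTranspose]

theorem cdet_eq_mooreDet [IsAddTorsionFree R] (hM : M.IsHermitian) (j : Fin n) :
    cdet j M = ((mooreDet M : R) : ℍ[R,a,b]) := by
  rw [(isHermitianOff_of_isHermitian hM j).cdet_eq_sum_cycleReProd, mooreDet,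
    ← QuaternionAlgebra.coe_algebraMap, map_sum]
  refine sum_eq_sum_of_involutive (involutive_reverseCycle j) fun σ => ?_
  have hstar : cycleProd M (reverseCycle σ j) j = star (cycleProd M σ j) :=
    cycleProd_reverseCycle_self fun y z _ _ => hM.apply y z
  have hre : ∀ τ, cycleReProd M τ ∅ = cycleReProd M τ {j} * (cycleProd M τ j).re := fun τ =>
    (cycleReProd_insert_mul_re M (by simp)).symm
  simp only [hre, map_zsmul, map_mul, QuaternionAlgebra.coe_algebraMap, sign_reverseCycle,
    cycleReProd_reverseCycle M (Finset.mem_singleton_self j), hstar, QuaternionAlgebra.re_star,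
    zero_mul, add_zero, ← QuaternionAlgebra.coe_mul_eq_smul, ← smul_add, ← mul_add,
    quaternion_add_star]

end HermitianOff

section EqualColumns

open Function Equiv Equiv.Perm

variable {R : Type*} [CommRing R] {a b : R} {n : ℕ} {N : Matrix (Fin n) (Fin n) ℍ[R,a,b]}
  {σ : Perm (Fin n)} {j l : Fin n}

theorem sign_smul_cycleProd_add_swap_mul (hcol : ∀ x, N x j = N x l) (h : ¬ σ.SameCycle j l) :
    (sign σ : ℤ) • cycleReProd N σ {j} • cycleProd N σ j +
        (sign (swap j l * σ) : ℤ) • cycleReProd N (swap j l * σ) {j} •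
          cycleProd N (swap j l * σ) j =
      (sign σ : ℤ) • cycleReProd N σ {j, l} •
        (cycleProd N σ j * (((cycleProd N σ l).re : ℍ[R,a,b]) - cycleProd N σ l)) := by
  have hjl : j ≠ l := fun hjl => h (hjl ▸ SameCycle.refl σ j)
  have hsplit : cycleReProd N σ {j} = cycleReProd N σ {j, l} * (cycleProd N σ l).re := by
    rw [Finset.pair_comm, cycleReProd_insert_mul_re N (by simpa using h)]
  rw [hsplit, cycleReProd_swap_mul N h, cycleProd_swap_mul h hcol, Perm.sign_mul, sign_swap hjl,
    mul_sub, smul_sub, smul_sub, QuaternionAlgebra.mul_coe_eq_smul, mul_smul]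
  simp [sub_eq_add_neg]

theorem IsHermitianOff.cdet_eq_zero_of_col_eq [IsAddTorsionFree R] (hN : IsHermitianOff N j)
    (hjl : j ≠ l) (hcol : ∀ x, N x j = N x l) : cdet j N = 0 := by
  rw [hN.cdet_eq_sum_cycleReProd, sum_eq_sum_ite_add_of_perm (Equiv.mulLeft (swap j l))
    (p := fun σ => ¬ σ.SameCycle j l) fun σ => not_congr (sameCycle_swap_mul_iff hjl)]
  refine (sum_eq_sum_of_involutive (involutive_reverseCycle l) (g := fun _ => 0)
    fun σ => ?_).trans Finset.sum_const_zero
  simp only [Equiv.coe_mulLeft, sameCycle_reverseCycle]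
  by_cases h : σ.SameCycle j l
  · simp only [h, not_true, if_false]
  have h' : ¬ (reverseCycle σ l).SameCycle j l := mt sameCycle_reverseCycle.1 h
  rw [if_pos h, if_pos h, sign_smul_cycleProd_add_swap_mul hcol h,
    sign_smul_cycleProd_add_swap_mul hcol h', sign_reverseCycle,
    cycleReProd_reverseCycle N (by simp), hN.cycleProd_reverseCycle h,
    cycleProd_reverseCycle_of_not_sameCycle N (mt SameCycle.symm h), QuaternionAlgebra.re_star,
    zero_mul, add_zero, ← smul_add, ← smul_add, ← mul_add, sub_add_sub_comm, quaternion_add_star,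
    sub_self, mul_zero, smul_zero, smul_zero, add_zero]

end EqualColumns

section Adjugate

open Function Equiv Equiv.Perm Matrix

/-- The matrix of the left cofactors: its `(j, k)` entry is the coefficient of the `(k, j)` entry
of the matrix in the `j`-th column determinant. -/
noncomputable def cdetAdjugate {R : Type*} [Ring R] {n : ℕ} (M : Matrix (Fin n) (Fin n) R) :
    Matrix (Fin n) (Fin n) R :=
  Matrix.of fun j k => cdet j (M.updateCol j (Pi.single k 1))

theorem cdet_updateCol {R : Type*} [Ring R] {n : ℕ} (M : Matrix (Fin n) (Fin n) R) (j : Fin n)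
    (c : Fin n → R) : cdet j (M.updateCol j c) = (cdetAdjugate M *ᵥ c) j := by
  choose u hu using exists_cycleProd_updateCol_eq_mul M (j := j)
  have hsum : ∀ c : Fin n → R, cdet j (M.updateCol j c) = ∑ σ : Perm (Fin n),
      (sign σ : ℤ) • ((cycleLeaders σ j).reverse.map (cycleProd M σ)).prod * u σ * c (σ⁻¹ j) :=
    fun c => Finset.sum_congr rfl fun σ _ => by
      rw [hu, List.map_congr_left fun x hx => cycleProd_updateCol_of_not_sameCycle M c
        (mem_cycleLeaders.1 (List.mem_reverse.1 hx)).1, smul_mul_assoc, smul_mul_assoc, mul_assoc]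
  simp only [Matrix.mulVec, dotProduct, cdetAdjugate, Matrix.of_apply, hsum, Finset.sum_mul]
  rw [Finset.sum_comm]
  refine Finset.sum_congr rfl fun σ _ => ?_
  simp [Pi.single_apply, mul_assoc]

variable {R : Type*} [CommRing R] {a b : R} {n : ℕ} {M N : Matrix (Fin n) (Fin n) ℍ[R,a,b]}
  {j : Fin n}

theorem IsHermitianOff.cdetAdjugate_mul_apply [IsAddTorsionFree R] (hN : IsHermitianOff N j) :
    (cdetAdjugate N * N) j = Pi.single j (cdet j N) := by
  ext1 l
  have hl : (cdetAdjugate N * N) j l = cdet j (N.updateCol j fun k => N k l) :=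
    (cdet_updateCol N j fun k => N k l).symm
  rcases eq_or_ne j l with rfl | hjl
  · rw [hl, Pi.single_eq_same, Matrix.updateCol_eq_self]
  · rw [hl, Pi.single_eq_of_ne hjl.symm]
    refine (hN.updateCol _).cdet_eq_zero_of_col_eq hjl fun x => ?_
    rw [Matrix.updateCol_self, Matrix.updateCol_ne hjl.symm]

theorem IsHermitianOff.cdet_updateCol_mulVec [IsAddTorsionFree R] (hN : IsHermitianOff N j)
    (c : Fin n → ℍ[R,a,b]) : cdet j (N.updateCol j (N *ᵥ c)) = cdet j N * c j := by
  rw [cdet_updateCol, Matrix.mulVec_mulVec, Matrix.mulVec, hN.cdetAdjugate_mul_apply,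
    single_dotProduct]

theorem IsHermitianOff.rdet_updateRow_vecMul [IsAddTorsionFree R] (hN : IsHermitianOff N j)
    (c : Fin n → ℍ[R,a,b]) : rdet j (N.updateRow j (c ᵥ* N)) = c j * rdet j N := by
  have hcol := congrArg star (hN.conjTranspose.cdet_updateCol_mulVec (star c))
  rwa [star_mul, star_cdet, star_cdet, Matrix.conjTranspose_conjTranspose,
    ← Matrix.updateRow_conjTranspose, Matrix.conjTranspose_conjTranspose, Matrix.star_mulVec,
    Matrix.conjTranspose_conjTranspose, star_star, Pi.star_apply, star_star] at hcol

theorem cdetAdjugate_mul_of_isHermitian [IsAddTorsionFree R] (hM : M.IsHermitian) :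
    cdetAdjugate M * M = mooreDet M • 1 := by
  ext1 j l
  have hrow := congrFun (isHermitianOff_of_isHermitian hM j).cdetAdjugate_mul_apply l
  rw [hrow, cdet_eq_mooreDet hM, Matrix.smul_apply, Matrix.one_apply, Pi.single_apply, smul_ite,
    smul_zero, ← QuaternionAlgebra.coe_mul_eq_smul, mul_one]
  exact if_congr eq_comm rfl rfl

end Adjugate

section Functoriality

open Function Equiv Matrix

variable {S T : Type*} [CommRing S] [CommRing T] {a b : S} {a' b' : T} {n : ℕ}

/-- The homomorphism of quaternion algebras induced by a homomorphism of the base rings that matches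
the parameters. -/
def quatMap (f : S →+* T) (ha : f a = a') (hb : f b = b') : ℍ[S,a,b] →+* ℍ[T,a',b'] where
  toFun x := ⟨f x.re, f x.imI, f x.imJ, f x.imK⟩
  map_zero' := by ext <;> simp
  map_one' := by ext <;> simp
  map_add' x y := by ext <;> simp
  map_mul' x y := by ext <;> simp [ha, hb]

variable (f : S →+* T) (ha : f a = a') (hb : f b = b')

theorem re_quatMap (x : ℍ[S,a,b]) : (quatMap f ha hb x).re = f x.re := rfl

theorem quatMap_star (x : ℍ[S,a,b]) : quatMap f ha hb (star x) = star (quatMap f ha hb x) := by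
  ext <;> simp [quatMap]

theorem quatMap_coe (r : S) : quatMap f ha hb (r : ℍ[S,a,b]) = ((f r : T) : ℍ[T,a',b']) := by
  ext <;> simp [quatMap]

theorem map_quatMap_conjTranspose (M : Matrix (Fin n) (Fin n) ℍ[S,a,b]) :
    Mᴴ.map (quatMap f ha hb) = (M.map (quatMap f ha hb))ᴴ :=
  Matrix.ext fun _ _ => quatMap_star f ha hb _

theorem map_quatMap_smul (r : S) (M : Matrix (Fin n) (Fin n) ℍ[S,a,b]) :
    (r • M).map (quatMap f ha hb) = f r • M.map (quatMap f ha hb) := by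
  ext1 i j
  simp only [Matrix.map_apply, Matrix.smul_apply, ← QuaternionAlgebra.coe_mul_eq_smul, map_mul,
    quatMap_coe]

theorem map_mooreDet (M : Matrix (Fin n) (Fin n) ℍ[S,a,b]) :
    f (mooreDet M) = mooreDet (M.map (quatMap f ha hb)) := by
  simp only [mooreDet, cycleReProd, map_sum, map_zsmul, map_prod, ← re_quatMap f ha hb,
    map_cycleProd]

theorem map_cdet {A B : Type*} [Ring A] [Ring B] (g : A →+* B) (j : Fin n)
    (M : Matrix (Fin n) (Fin n) A) : g (cdet j M) = cdet j (M.map g) := by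
  simp only [cdet, map_sum, map_zsmul, map_mul, map_list_prod, List.map_map, comp_def,
    map_cycleProd]

theorem map_cdetAdjugate {A B : Type*} [Ring A] [Ring B] (g : A →+* B)
    (M : Matrix (Fin n) (Fin n) A) : (cdetAdjugate M).map g = cdetAdjugate (M.map g) := by
  ext1 j k
  have hsingle : g ∘ Pi.single k 1 = Pi.single k 1 := by
    ext i
    rw [Function.comp_apply, Pi.apply_single (fun _ => g) (fun _ => map_zero g), map_one]
  rw [Matrix.map_apply, cdetAdjugate, cdetAdjugate, Matrix.of_apply, Matrix.of_apply, map_cdet,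
    Matrix.map_updateCol, hsingle]

theorem mooreDet_one : mooreDet (1 : Matrix (Fin n) (Fin n) ℍ[S,a,b]) = 1 := by
  rw [mooreDet, Finset.sum_eq_single 1 (fun σ _ hσ => ?_) fun h => absurd (Finset.mem_univ _) h]
  · have hcycle : ∀ x, cycleProd (1 : Matrix (Fin n) (Fin n) ℍ[S,a,b]) 1 x = 1 := fun x => by
      rw [cycleProd_eq_prod_iterate, Perm.coe_one, minimalPeriod_id, List.range_one,
        List.map_singleton, List.prod_singleton, iterate_id, iterate_id, id, Matrix.one_apply_eq]
    simp [cycleReProd, hcycle]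
  · obtain ⟨j, hj⟩ : ∃ j, σ j ≠ j := not_forall.1 fun h => hσ (Perm.ext h)
    obtain ⟨u, hu, -⟩ := exists_cycleProd_eq_mul (1 : Matrix (Fin n) (Fin n) ℍ[S,a,b]) σ j
    rw [← cycleReProd_insert_mul_re _ (l := j) (by simp), hu, Matrix.one_apply_ne hj.symm,
      zero_mul, QuaternionAlgebra.re_zero, mul_zero, smul_zero]

end Functoriality

section Generic

open Matrix

variable {R : Type*} [CommRing R] {a b : R} {n : ℕ}

variable (R) in
/-- The evaluation of the polynomials over `ℤ` whose indeterminates are the elements of `R`. -/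
noncomputable def tautologicalEval : MvPolynomial R ℤ →+* R :=
  (MvPolynomial.aeval id).toRingHom

theorem tautologicalEval_X (r : R) : tautologicalEval R (MvPolynomial.X r) = r :=
  MvPolynomial.aeval_X _ r

variable (a b) in
/-- The homomorphism from the quaternion algebra with generic parameters to the given one. -/
noncomputable def evalQuat :
    ℍ[MvPolynomial R ℤ,MvPolynomial.X a,MvPolynomial.X b] →+* ℍ[R,a,b] :=
  quatMap (tautologicalEval R) (tautologicalEval_X a) (tautologicalEval_X b)

variable (a b) in
/-- The specialization of the quaternion algebra with generic parameters in which all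
indeterminates vanish. -/
noncomputable def constantCoeffQuat :
    ℍ[MvPolynomial R ℤ,MvPolynomial.X a,MvPolynomial.X b] →+* ℍ[ℤ,0,0] :=
  quatMap MvPolynomial.constantCoeff (MvPolynomial.constantCoeff_X ℤ a)
    (MvPolynomial.constantCoeff_X ℤ b)

theorem exists_map_evalQuat_eq (A : Matrix (Fin n) (Fin n) ℍ[R,a,b]) :
    ∃ G : Matrix (Fin n) (Fin n) ℍ[MvPolynomial R ℤ,MvPolynomial.X a,MvPolynomial.X b],
      G.map (evalQuat a b) = A ∧ G.map (constantCoeffQuat a b) = 1 := by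
  let D : Matrix (Fin n) (Fin n) ℍ[MvPolynomial R ℤ,MvPolynomial.X a,MvPolynomial.X b] :=
    Matrix.of fun i j => ⟨.X ((A - 1) i j).re, .X ((A - 1) i j).imI, .X ((A - 1) i j).imJ,
      .X ((A - 1) i j).imK⟩
  have hD : D.map (evalQuat a b) = A - 1 := Matrix.ext fun i j => QuaternionAlgebra.ext
    (tautologicalEval_X _) (tautologicalEval_X _) (tautologicalEval_X _) (tautologicalEval_X _)
  have hD₀ : D.map (constantCoeffQuat a b) = 0 := Matrix.ext fun i j => by
    ext <;> exact MvPolynomial.constantCoeff_X _ _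
  refine ⟨1 + D, ?_, ?_⟩
  · rw [Matrix.map_add _ (map_add _), hD, Matrix.map_one _ (map_zero _) (map_one _),
      add_sub_cancel]
  · rw [Matrix.map_add _ (map_add _), hD₀, Matrix.map_one _ (map_zero _) (map_one _), add_zero]

theorem cdet_conjTranspose_mul_self (A : Matrix (Fin n) (Fin n) ℍ[R,a,b]) (j : Fin n) :
    cdet j (Aᴴ * A) = ((mooreDet (Aᴴ * A) : R) : ℍ[R,a,b]) := by
  obtain ⟨G, rfl, -⟩ := exists_map_evalQuat_eq A
  rw [evalQuat, ← map_quatMap_conjTranspose, ← Matrix.map_mul, ← map_cdet,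
    cdet_eq_mooreDet (Matrix.isHermitian_conjTranspose_mul_self G), ← map_mooreDet, quatMap_coe]

theorem rdet_conjTranspose_mul_self (A : Matrix (Fin n) (Fin n) ℍ[R,a,b]) (j : Fin n) :
    rdet j (Aᴴ * A) = ((mooreDet (Aᴴ * A) : R) : ℍ[R,a,b]) := by
  rw [← (Matrix.isHermitian_conjTranspose_mul_self A).eq, ← star_cdet,
    cdet_conjTranspose_mul_self, QuaternionAlgebra.star_coe]
  rw [(Matrix.isHermitian_conjTranspose_mul_self A).eq]

theorem cdetAdjugate_mul_conjTranspose_mul_self (A : Matrix (Fin n) (Fin n) ℍ[R,a,b]) :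
    cdetAdjugate (Aᴴ * A) * (Aᴴ * A) = mooreDet (Aᴴ * A) • 1 := by
  obtain ⟨G, rfl, -⟩ := exists_map_evalQuat_eq A
  rw [evalQuat, ← map_quatMap_conjTranspose, ← Matrix.map_mul, ← map_cdetAdjugate,
    ← Matrix.map_mul, cdetAdjugate_mul_of_isHermitian (Matrix.isHermitian_conjTranspose_mul_self G),
    map_quatMap_smul, Matrix.map_one _ (map_zero _) (map_one _), map_mooreDet]

theorem isUnit_of_isUnit_mooreDet {A : Matrix (Fin n) (Fin n) ℍ[R,a,b]}
    (hl : IsUnit (mooreDet (Aᴴ * A))) (hr : IsUnit (mooreDet (A * Aᴴ))) : IsUnit A := by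
  have hleft : ∀ B : Matrix (Fin n) (Fin n) ℍ[R,a,b], IsUnit (mooreDet (Bᴴ * B)) →
      ∃ C, C * B = 1 := fun B hB => by
    refine ⟨Ring.inverse (mooreDet (Bᴴ * B)) • (cdetAdjugate (Bᴴ * B) * Bᴴ), ?_⟩
    rw [smul_mul_assoc, mul_assoc, cdetAdjugate_mul_conjTranspose_mul_self, smul_smul,
      Ring.inverse_mul_cancel _ hB, one_smul]
  obtain ⟨C, hC⟩ := hleft Aᴴ (by rwa [Matrix.conjTranspose_conjTranspose])
  refine isUnit_iff_exists_and_exists.2 ⟨⟨Cᴴ, ?_⟩, hleft A hl⟩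
  rw [← Matrix.conjTranspose_conjTranspose A, ← Matrix.conjTranspose_mul, hC,
    Matrix.conjTranspose_one]

end Generic

section Multiplicativity

open Matrix

variable {R : Type*} [CommRing R] {a b : R} {n : ℕ} {M B : Matrix (Fin n) (Fin n) ℍ[R,a,b]}
  {j : Fin n}

theorem mooreDet_conj_updateCol_one [IsAddTorsionFree R] (hM : M.IsHermitian) (j : Fin n)
    (c : Fin n → ℍ[R,a,b]) :
    mooreDet ((updateCol 1 j c)ᴴ * M * updateCol 1 j c) = (star (c j) * c j).re * mooreDet M := by
  have hcol : M * updateCol 1 j c = M.updateCol j (M *ᵥ c) := by rw [mul_updateCol, mul_one]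
  have hrow : (updateCol 1 j c)ᴴ * M * updateCol 1 j c =
      (M.updateCol j (M *ᵥ c)).updateRow j (star c ᵥ* M.updateCol j (M *ᵥ c)) := by
    rw [mul_assoc, hcol, ← updateRow_conjTranspose, conjTranspose_one, updateRow_mul, one_mul]
  have hMj := isHermitianOff_of_isHermitian hM j
  have hE := isHermitian_conjTranspose_mul_mul (updateCol 1 j c) hM
  have hdet := cdet_eq_mooreDet hE j
  rw [← (isHermitianOff_of_isHermitian hE j).rdet_eq_cdet, hrow,
    (hMj.updateCol _).rdet_updateRow_vecMul, (hMj.updateCol _).rdet_eq_cdet,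
    hMj.cdet_updateCol_mulVec, cdet_eq_mooreDet hM, ← hrow, Pi.star_apply,
    QuaternionAlgebra.coe_mul_eq_smul, mul_smul_comm] at hdet
  rw [← QuaternionAlgebra.re_coe (mooreDet _), ← hdet, QuaternionAlgebra.re_smul, smul_eq_mul,
    mul_comm]

variable (R a b n) in
/-- The matrices `B` for which both congruences `M ↦ Bᴴ * M * B` and `M ↦ B * M * Bᴴ` multiply the
Moore determinant of Hermitian matrices by the same constant. -/
def mooreMultiplicative : Submonoid (Matrix (Fin n) (Fin n) ℍ[R,a,b]) where
  carrier := {B | ∃ r, ∀ M, M.IsHermitian →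
    mooreDet (Bᴴ * M * B) = r * mooreDet M ∧ mooreDet (B * M * Bᴴ) = r * mooreDet M}
  one_mem' := ⟨1, fun M _ => by simp⟩
  mul_mem' := by
    rintro B C ⟨r, hB⟩ ⟨s, hC⟩
    refine ⟨r * s, fun M hM => ⟨?_, ?_⟩⟩
    · rw [mul_comm r, mul_assoc s, ← (hB M hM).1,
        ← (hC _ (isHermitian_conjTranspose_mul_mul B hM)).1, conjTranspose_mul]
      simp only [mul_assoc]
    · rw [mul_assoc r, ← (hC M hM).2, ← (hB _ (isHermitian_mul_mul_conjTranspose C hM)).2,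
        conjTranspose_mul]
      simp only [mul_assoc]

theorem mem_mooreMultiplicative_iff : B ∈ mooreMultiplicative R a b n ↔ ∀ M, M.IsHermitian →
    mooreDet (Bᴴ * M * B) = mooreDet (Bᴴ * B) * mooreDet M ∧
      mooreDet (B * M * Bᴴ) = mooreDet (Bᴴ * B) * mooreDet M := by
  refine ⟨?_, fun h => ⟨_, h⟩⟩
  rintro ⟨r, hr⟩
  have hr₁ := (hr 1 isHermitian_one).1
  rw [mul_one, mooreDet_one, mul_one] at hr₁
  rwa [hr₁]

theorem updateCol_one_mem_of_conjTranspose_eq [IsAddTorsionFree R] {i : Fin n}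
    {c d : Fin n → ℍ[R,a,b]} (h : (updateCol 1 j c)ᴴ = updateCol 1 i d)
    (hcd : (star (d i) * d i).re = (star (c j) * c j).re) :
    updateCol 1 j c ∈ mooreMultiplicative R a b n := by
  refine ⟨(star (c j) * c j).re, fun M hM => ⟨mooreDet_conj_updateCol_one hM j c, ?_⟩⟩
  have hd := mooreDet_conj_updateCol_one hM i d
  rwa [← h, conjTranspose_conjTranspose, hcd] at hd

theorem updateCol_one_single_mem [IsAddTorsionFree R] (j : Fin n) (x : ℍ[R,a,b]) :
    updateCol 1 j (Pi.single j x) ∈ mooreMultiplicative R a b n := by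
  refine updateCol_one_mem_of_conjTranspose_eq (i := j) (d := Pi.single j (star x)) ?_ ?_
  · ext1 k l
    simp only [conjTranspose_apply, updateCol_apply, Pi.single_apply, one_apply]
    grind [star_zero, star_one]
  · rw [Pi.single_eq_same, Pi.single_eq_same, star_star, re_quaternion_mul_comm]

theorem updateCol_one_add_single_mem [IsAddTorsionFree R] {i : Fin n} (hij : i ≠ j)
    (x : ℍ[R,a,b]) :
    updateCol 1 j (Pi.single j 1 + Pi.single i x) ∈ mooreMultiplicative R a b n := by
  refine updateCol_one_mem_of_conjTranspose_eq (i := i)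
    (d := Pi.single i 1 + Pi.single j (star x)) ?_ ?_
  · ext1 k l
    simp only [conjTranspose_apply, updateCol_apply, Pi.single_apply, Pi.add_apply, one_apply]
    grind [star_zero, star_one, add_zero, zero_add, star_add]
  · simp [hij, hij.symm]

theorem updateCol_one_mul_updateCol_one_add_single {i : Fin n} (hij : i ≠ j) (c : Fin n → ℍ[R,a,b])
    (x : ℍ[R,a,b]) :
    updateCol 1 j c * updateCol 1 j (Pi.single j 1 + Pi.single i x) =
      updateCol 1 j (c + Pi.single i x) := by
  have hmulVec : updateCol 1 j c *ᵥ (Pi.single j 1 + Pi.single i x) = c + Pi.single i x := by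
    rw [mulVec_add, mulVec_single_one, mulVec_single]
    ext1 k
    simp [col_apply, updateCol_ne hij, one_apply, Pi.single_apply]
  rw [mul_updateCol, mul_one, updateCol_idem, hmulVec]

theorem updateCol_one_mem [IsAddTorsionFree R] (j : Fin n) (c : Fin n → ℍ[R,a,b]) :
    updateCol 1 j c ∈ mooreMultiplicative R a b n := by
  have hpartial : ∀ s : Finset (Fin n), j ∉ s → updateCol 1 j
      (Pi.single j (c j) + ∑ i ∈ s, Pi.single i (c i)) ∈ mooreMultiplicative R a b n := by
    intro s hs
    induction s using Finset.induction_on with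
    | empty => simpa only [Finset.sum_empty, add_zero] using updateCol_one_single_mem j (c j)
    | insert i s his ih =>
      obtain ⟨hji, hjs⟩ := not_or.1 (mt Finset.mem_insert.2 hs)
      rw [Finset.sum_insert his, add_left_comm, add_comm,
        ← updateCol_one_mul_updateCol_one_add_single (Ne.symm hji)]
      exact mul_mem (ih hjs) (updateCol_one_add_single_mem (Ne.symm hji) _)
  have hc := hpartial (Finset.univ.erase j) (Finset.notMem_erase j _)
  rwa [Finset.add_sum_erase _ (fun i => Pi.single i (c i)) (Finset.mem_univ j),
    Finset.univ_sum_single] at hc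

/-- The matrix whose columns in `s` are those of `B`, and whose other columns are those of the
identity matrix. -/
def truncateCols {ι A : Type*} [DecidableEq ι] [Zero A] [One A] (s : Finset ι) (B : Matrix ι ι A) :
    Matrix ι ι A :=
  Matrix.of fun i => s.piecewise (B i) ((1 : Matrix ι ι A) i)

theorem truncateCols_one {ι A : Type*} [DecidableEq ι] [Zero A] [One A] (s : Finset ι) :
    truncateCols s (1 : Matrix ι ι A) = 1 := by
  simp only [truncateCols, Finset.piecewise_same]
  rfl

theorem truncateCols_insert {ι A : Type*} [DecidableEq ι] [Zero A] [One A] (s : Finset ι)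
    (B : Matrix ι ι A) (j : ι) :
    truncateCols (insert j s) B = (truncateCols s B).updateCol j (B.col j) := by
  ext1 i k
  rcases eq_or_ne k j with rfl | hkj
  · rw [updateCol_self, truncateCols, of_apply, col_apply,
      Finset.piecewise_eq_of_mem _ _ _ (Finset.mem_insert_self k s)]
  · rw [updateCol_ne hkj, truncateCols, of_apply, Finset.piecewise_insert_of_ne _ _ _ hkj]
    rfl

theorem map_truncateCols {ι A C : Type*} [DecidableEq ι] [Ring A] [Ring C] (g : A →+* C)
    (s : Finset ι) (B : Matrix ι ι A) : (truncateCols s B).map g = truncateCols s (B.map g) := by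
  ext1 i k
  simp only [truncateCols, Matrix.map_apply, of_apply, Finset.piecewise, one_apply]
  split_ifs <;> simp

theorem mem_mooreMultiplicative_of_isUnit_truncateCols [IsAddTorsionFree R]
    (hB : ∀ s, IsUnit (truncateCols s B)) : B ∈ mooreMultiplicative R a b n := by
  have hmem : ∀ s, truncateCols s B ∈ mooreMultiplicative R a b n := fun s => by
    induction s using Finset.induction_on with
    | empty =>
      have hone : truncateCols ∅ B = 1 := by simp only [truncateCols, Finset.piecewise_empty]; rfl
      exact hone ▸ one_mem _
    | insert j s _ ih =>
      obtain ⟨C, hC⟩ := (hB s).exists_right_inv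
      have hmul : truncateCols (insert j s) B =
          truncateCols s B * updateCol 1 j (C *ᵥ B.col j) := by
        rw [mul_updateCol, mul_one, mulVec_mulVec, hC, one_mulVec, truncateCols_insert]
      exact hmul ▸ mul_mem ih (updateCol_one_mem j _)
  have huniv : truncateCols Finset.univ B = B := by
    simp only [truncateCols, Finset.piecewise_univ]; rfl
  exact huniv ▸ hmem Finset.univ

theorem mem_mooreMultiplicative_of_map {S : Type*} [CommRing S] {a' b' : S} {f : R →+* S}
    (hf : Function.Injective f) (ha : f a = a') (hb : f b = b')
    (hB : B.map (quatMap f ha hb) ∈ mooreMultiplicative S a' b' n) :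
    B ∈ mooreMultiplicative R a b n := by
  refine ⟨mooreDet (Bᴴ * B), fun M hM => ?_⟩
  have hM' : (M.map (quatMap f ha hb)).IsHermitian := by
    rw [IsHermitian, ← map_quatMap_conjTranspose, hM.eq]
  obtain ⟨hl, hr⟩ := mem_mooreMultiplicative_iff.1 hB _ hM'
  simp only [← map_quatMap_conjTranspose, ← Matrix.map_mul, ← map_mooreDet, ← map_mul] at hl hr
  exact ⟨hf hl, hf hr⟩

theorem mem_mooreMultiplicative_of_map_eq_one [CharZero R] [IsDomain R] {S : Type*} [CommRing S]
    [Nontrivial S] {a' b' : S} {f : R →+* S} (ha : f a = a') (hb : f b = b')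
    (hB : B.map (quatMap f ha hb) = 1) : B ∈ mooreMultiplicative R a b n := by
  have hne : ∀ T : Matrix (Fin n) (Fin n) ℍ[R,a,b], T.map (quatMap f ha hb) = 1 →
      mooreDet (Tᴴ * T) ≠ 0 := fun T hT h => by
    have hf := map_mooreDet f ha hb (Tᴴ * T)
    rw [h, Matrix.map_mul, map_quatMap_conjTranspose, hT, conjTranspose_one, one_mul, mooreDet_one,
      map_zero] at hf
    exact zero_ne_one hf
  have hunit : ∀ T : Matrix (Fin n) (Fin n) ℍ[R,a,b], T.map (quatMap f ha hb) = 1 →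
      IsUnit (algebraMap R (FractionRing R) (mooreDet (Tᴴ * T))) := fun T hT =>
    isUnit_iff_ne_zero.2 fun h => hne T hT (IsFractionRing.injective R (FractionRing R)
      (h.trans (map_zero _).symm))
  refine mem_mooreMultiplicative_of_map (IsFractionRing.injective R (FractionRing R)) rfl rfl
    (mem_mooreMultiplicative_of_isUnit_truncateCols fun s => ?_)
  have hT : (truncateCols s B).map (quatMap f ha hb) = 1 := by
    rw [map_truncateCols, hB, truncateCols_one]
  have hl := hunit _ hT
  have hr := hunit (truncateCols s B)ᴴ (by rw [map_quatMap_conjTranspose, hT, conjTranspose_one])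
  rw [map_mooreDet _ rfl rfl, Matrix.map_mul] at hl hr
  rw [conjTranspose_conjTranspose, map_quatMap_conjTranspose] at hr
  rw [map_quatMap_conjTranspose] at hl
  rw [← map_truncateCols]
  exact isUnit_of_isUnit_mooreDet hl hr

theorem mooreDet_mul_conjTranspose_self (A : Matrix (Fin n) (Fin n) ℍ[R,a,b]) :
    mooreDet (A * Aᴴ) = mooreDet (Aᴴ * A) := by
  obtain ⟨G, rfl, hG⟩ := exists_map_evalQuat_eq A
  have hG' := (mem_mooreMultiplicative_iff.1 (mem_mooreMultiplicative_of_map_eq_one _ _ hG) 1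
    isHermitian_one).2
  rw [mul_one, mooreDet_one, mul_one] at hG'
  rw [evalQuat, ← map_quatMap_conjTranspose, ← Matrix.map_mul, ← Matrix.map_mul, ← map_mooreDet,
    ← map_mooreDet, hG']

theorem mooreDet_conjTranspose_mul_mul (A B : Matrix (Fin n) (Fin n) ℍ[R,a,b]) :
    mooreDet ((A * B)ᴴ * (A * B)) = mooreDet (Aᴴ * A) * mooreDet (Bᴴ * B) := by
  obtain ⟨G, rfl, -⟩ := exists_map_evalQuat_eq A
  obtain ⟨H, rfl, hH⟩ := exists_map_evalQuat_eq B
  have hGH := (mem_mooreMultiplicative_iff.1 (mem_mooreMultiplicative_of_map_eq_one _ _ hH) _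
    (isHermitian_conjTranspose_mul_self G)).1
  have hassoc : (G * H)ᴴ * (G * H) = Hᴴ * (Gᴴ * G) * H := by
    simp only [conjTranspose_mul, mul_assoc]
  simp only [evalQuat, ← map_quatMap_conjTranspose, ← Matrix.map_mul, ← map_mooreDet, ← map_mul,
    hassoc, hGH, mul_comm]

end Multiplicativity

section Inverse

open Matrix

variable {R : Type*} [CommRing R] {a b : R} {n : ℕ} {A : Matrix (Fin n) (Fin n) ℍ[R,a,b]}

theorem isUnit_iff_isUnit_mooreDet : IsUnit A ↔ IsUnit (mooreDet (Aᴴ * A)) := by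
  refine ⟨fun hA => ?_, fun h => isUnit_of_isUnit_mooreDet h ?_⟩
  · obtain ⟨B, hB⟩ := hA.exists_right_inv
    refine IsUnit.of_mul_eq_one (mooreDet (Bᴴ * B)) ?_
    rw [← mooreDet_conjTranspose_mul_mul, hB, conjTranspose_one, one_mul, mooreDet_one]
  · rwa [mooreDet_mul_conjTranspose_self]

theorem inverse_conjTranspose_mul_self (hA : IsUnit A) :
    Ring.inverse (Aᴴ * A) = Ring.inverse (mooreDet (Aᴴ * A)) • cdetAdjugate (Aᴴ * A) := by
  have hAA : IsUnit (Aᴴ * A) := hA.star.mul hA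
  refine (left_inv_eq_right_inv ?_ (Ring.mul_inverse_cancel _ hAA)).symm
  rw [smul_mul_assoc, cdetAdjugate_mul_conjTranspose_mul_self, smul_smul,
    Ring.inverse_mul_cancel _ (isUnit_iff_isUnit_mooreDet.1 hA), one_smul]

theorem inverse_conjTranspose_mul_self_mul_conjTranspose (hA : IsUnit A) :
    Ring.inverse (Aᴴ * A) * Aᴴ = Ring.inverse (mooreDet (Aᴴ * A)) •
      Matrix.of fun i j => cdet i ((Aᴴ * A).updateCol i fun k => Aᴴ k j) := by
  rw [inverse_conjTranspose_mul_self hA, smul_mul_assoc]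
  exact congrArg _ (Matrix.ext fun i j => (cdet_updateCol (Aᴴ * A) i fun k => Aᴴ k j).symm)

theorem conjTranspose_mul_inverse_mul_conjTranspose_self (hA : IsUnit A) :
    Aᴴ * Ring.inverse (A * Aᴴ) = Ring.inverse (mooreDet (A * Aᴴ)) •
      Matrix.of fun i j => rdet j ((A * Aᴴ).updateRow j fun k => Aᴴ i k) := by
  have hleft := congrArg star (inverse_conjTranspose_mul_self_mul_conjTranspose hA.star)
  simp only [star_eq_conjTranspose, conjTranspose_conjTranspose] at hleft
  rw [conjTranspose_mul, ← star_eq_conjTranspose (Ring.inverse _), ← Ring.inverse_star,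
    star_eq_conjTranspose, (isHermitian_mul_conjTranspose_self A).eq] at hleft
  rw [hleft]
  ext1 i j
  rw [conjTranspose_apply, Matrix.smul_apply, Matrix.smul_apply, QuaternionAlgebra.star_smul,
    of_apply, of_apply, star_cdet, ← updateRow_conjTranspose,
    (isHermitian_mul_conjTranspose_self A).eq]
  rfl

theorem ddet_eq_mooreDet {F : Type*} [Field F] {a b : F} [NeZero n]
    (A : Matrix (Fin n) (Fin n) ℍ[F,a,b]) : ddet A = mooreDet (Aᴴ * A) := by
  rw [ddet, hermDet, rdet_conjTranspose_mul_self, QuaternionAlgebra.re_coe]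

end Inverse

theorem mainTheorem2_general {R : Type*} [CommRing R] (a b : R) {n : ℕ}
    (A : Matrix (Fin n) (Fin n) ℍ[R,a,b]) :
    (∀ i, rdet i (Aᴴ * A) = ((mooreDet (Aᴴ * A) : R) : ℍ[R,a,b]) ∧
      cdet i (Aᴴ * A) = ((mooreDet (Aᴴ * A) : R) : ℍ[R,a,b]) ∧
      rdet i (A * Aᴴ) = ((mooreDet (Aᴴ * A) : R) : ℍ[R,a,b]) ∧
      cdet i (A * Aᴴ) = ((mooreDet (Aᴴ * A) : R) : ℍ[R,a,b])) ∧
    (IsUnit A ↔ IsUnit (mooreDet (Aᴴ * A))) ∧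
    (IsUnit (mooreDet (Aᴴ * A)) →
      IsUnit (Aᴴ * A) ∧ IsUnit (A * Aᴴ) ∧
      Ring.inverse (Aᴴ * A) * Aᴴ * A = 1 ∧ A * (Aᴴ * Ring.inverse (A * Aᴴ)) = 1 ∧
      Ring.inverse A = Ring.inverse (Aᴴ * A) * Aᴴ ∧
      Ring.inverse (Aᴴ * A) * Aᴴ = Aᴴ * Ring.inverse (A * Aᴴ) ∧
      Ring.inverse (Aᴴ * A) * Aᴴ = Ring.inverse (mooreDet (Aᴴ * A)) •
        Matrix.of (fun i j => cdet i ((Aᴴ * A).updateCol i fun k => Aᴴ k j)) ∧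
      Aᴴ * Ring.inverse (A * Aᴴ) = Ring.inverse (mooreDet (A * Aᴴ)) •
        Matrix.of (fun i j => rdet j ((A * Aᴴ).updateRow j fun k => Aᴴ i k))) := by
  refine ⟨fun i => ⟨rdet_conjTranspose_mul_self A i, cdet_conjTranspose_mul_self A i, ?_, ?_⟩,
    isUnit_iff_isUnit_mooreDet, fun h => ?_⟩
  · simpa [mooreDet_mul_conjTranspose_self] using rdet_conjTranspose_mul_self Aᴴ i
  · simpa [mooreDet_mul_conjTranspose_self] using cdet_conjTranspose_mul_self Aᴴ i
  have hA : IsUnit A := isUnit_iff_isUnit_mooreDet.2 h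
  have hl : IsUnit (Aᴴ * A) := hA.star.mul hA
  have hr : IsUnit (A * Aᴴ) := hA.mul hA.star
  have hleft : Ring.inverse (Aᴴ * A) * Aᴴ * A = 1 := by
    rw [mul_assoc, Ring.inverse_mul_cancel _ hl]
  have hright : A * (Aᴴ * Ring.inverse (A * Aᴴ)) = 1 := by
    rw [← mul_assoc, Ring.mul_inverse_cancel _ hr]
  exact ⟨hl, hr, hleft, hright,
    (left_inv_eq_right_inv hleft (Ring.mul_inverse_cancel _ hA)).symm,
    left_inv_eq_right_inv hleft hright, inverse_conjTranspose_mul_self_mul_conjTranspose hA,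
    conjTranspose_mul_inverse_mul_conjTranspose_self hA⟩

theorem mainTheorem2 {F : Type*} [Field F] (a b : F) {n : ℕ} [NeZero n]
    (A : Matrix (Fin n) (Fin n) ℍ[F,a,b]) :
    -- `ddet A` is the common value in `F` of all row and column determinants of `A* A` and `A A*`
    (∀ i, rdet i (Aᴴ * A) = ((ddet A : F) : ℍ[F,a,b]) ∧
      cdet i (Aᴴ * A) = ((ddet A : F) : ℍ[F,a,b]) ∧
      rdet i (A * Aᴴ) = ((ddet A : F) : ℍ[F,a,b]) ∧
      cdet i (A * Aᴴ) = ((ddet A : F) : ℍ[F,a,b])) ∧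
    (IsUnit A ↔ ddet A ≠ 0) ∧
    (ddet A ≠ 0 →
      IsUnit (Aᴴ * A) ∧ IsUnit (A * Aᴴ) ∧
      leftInv A * A = 1 ∧ A * rightInv A = 1 ∧
      Ring.inverse A = leftInv A ∧ leftInv A = rightInv A ∧
      leftInv A = (ddet A)⁻¹ • Matrix.of (fun i j => leftDoubleCofactor A j i) ∧
      rightInv A = (ddet Aᴴ)⁻¹ • Matrix.of (fun i j => rightDoubleCofactor A j i)) := by
  simpa only [ddet_eq_mooreDet, leftInv, rightInv, leftDoubleCofactor, rightDoubleCofactor,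
    Matrix.conjTranspose_conjTranspose, isUnit_iff_ne_zero, Ring.inverse_eq_inv'] using
    mainTheorem2_general a b A
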